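/- Let $L\ge 1$ be an integer, let $\mathcal W^{(1)},\dots,\mathcal W^{(L)}$ be finite alphabets, and let $(W^{(1)},\dots,W^{(L)})$ be random variables with an arbitrary joint distribution on $\mathcal W^{(1)}\times\dots\times\mathcal W^{(L)}$. A discrete memoryless source emits i.i.d. copies $(W^{(1)}_i,\dots,W^{(L)}_i)$, $i=1,\dots,n$, and node $l$ observes $\boldsymbol W^{(l)}=(W^{(l)}_1,\dots,W^{(l)}_n)$. A source code of length $n\ge 1$ consists of finite message sets $\mathcal M^{(1)},\dots,\mathcal M^{(L)}$ and, for each node $l$, a compressor $\phi^{(l)}:(\mathcal W^{(l)})^n\to\mathcal M^{(l)}$ and a decompressor $\psi^{(l)}:(\mathcal W^{(l)})^n\times\mathcal M^{(1)}\times\dots\times\mathcal M^{(L)}\to(\mathcal W^{(1)})^n\times\dots\times(\mathcal W^{(L)})^n$. Its error probability is $$P_{\mathrm e}=\mathbb P\big[\psi^{(l)}\big(\boldsymbol W^{(l)},\phi^{(1)}(\boldsymbol W^{(1)}),\dots,\phi^{(L)}(\boldsymbol W^{(L)})\big)\ne(\boldsymbol W^{(1)},\dots,\boldsymbol W^{(L)})\text{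 for one or more } l\in\{1,\dots,L\}\big],$$ and the compression rate of node $l$ is $\eta^{(l)}=\frac1n\log_2|\mathcal M^{(l)}|$. A tuple $(r^{(1)},\dots,r^{(L)})$ of nonnegative real numbers is achievable if for every $\epsilon>0$ there exist source codes of arbitrarily large length $n$ with $P_{\mathrm e}\le\epsilon$ and $\eta^{(l)}\le r^{(l)}+\epsilon$ for all $l$. The source-coding rate region $\mathcal R$ is the set of all achievable tuples. Then $\mathcal R$ is equal to the set of all tuples $(r^{(1)},\dots,r^{(L)})$ of nonnegative real numbers such that $$\sum_{l\in\mathcal L}r^{(l)}\ \ge\ H\big(W^{\mathcal L}\,\big|\,W^{\mathcal L^c}\big)$$ for every nonempty strict subset $\mathcal L$ of $\{1,\dots,L\}$, where $\mathcal L^c=\{1,\dots,L\}\setminus\mathcal L$, $W^{\mathcal L}=(W^{(l)})_{l\in\mathcal L}$, and $H(\cdot\,|\,\cdot)$ is conditional entropy in bits (base-2 logarithm). -/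

import Mathlib

/-!
Multi-source multicast source coding.  A discrete memoryless source with `L` components is given by
the joint law `p` of one letter `(W₁, …, W_L)` on the product of the finite alphabets `W l`.
-/

noncomputable section

open scoped Classical in
/-- The conditional entropy `H(X | Y)` in bits of a pair `(X, Y)` of finitely-valued random variables
with joint law `q`, i.e. `-∑ q(x,y) log₂ (q(x,y) / q_Y(y))`. The terms with `q(x,y) = 0` vanish. -/
def condEntropy {α β : Type*} [Fintype α] [Fintype β] (q : PMF (α × β)) : ℝ :=
  -∑ x : α, ∑ y : β,
    (q (x, y)).toReal * Real.logb 2 ((q (x, y)).toReal / (q.map Prod.snd y).toReal)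

/-- The conditional entropy `H(W_S | W_{Sᶜ})` of the components with index in `S` given all the
other components, for `(W₁, …, W_L)` with joint law `p`. -/
def sourceCondEntropy {L : ℕ} {W : Fin L → Type*} [∀ l, Fintype (W l)]
    (p : PMF (∀ l, W l)) (S : Finset (Fin L)) : ℝ :=
  condEntropy (p.map fun w => (S.restrict w, Sᶜ.restrict w))

/-- A source code of length `n`: finite message sets (with `M l` elements at node `l`), a compressor
at each node, and at each node a decompressor whose inputs are the node's own source string and the
messages of all nodes, and whose output is an estimate of all source strings. -/
structure SourceCode {L : ℕ} (W : Fin L → Type*) (n : ℕ) where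
  M : Fin L → ℕ
  enc : ∀ l, (Fin n → W l) → Fin (M l)
  dec : ∀ l, (Fin n → W l) → (∀ k, Fin (M k)) → ∀ k, Fin n → W k

namespace SourceCode

variable {L : ℕ} {W : Fin L → Type*} {n : ℕ}

/-- The compression rate of node `l`, in bits per source letter. -/
def rate (C : SourceCode W n) (l : Fin L) : ℝ :=
  1 / (n : ℝ) * Real.logb 2 (C.M l)

/-- The estimate of all source strings that node `l` forms when the emitted string is `w`. -/
def estimate (C : SourceCode W n) (w : Fin n → ∀ k, W k) (l : Fin L) : ∀ k, Fin n → W k :=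
  C.dec l (fun i => w i l) (fun k => C.enc k (fun i => w i k))

open scoped Classical in
/-- The joint decoding error probability: the probability, for `n` i.i.d. letters with law `p`, that
the estimate of at least one node differs from the emitted source strings. -/
def errorProb [∀ l, Fintype (W l)] (C : SourceCode W n) (p : PMF (∀ l, W l)) : ℝ :=
  ∑ w : Fin n → ∀ k, W k,
    if ∃ l, C.estimate w l ≠ fun k i => w i k then ∏ i, (p (w i)).toReal else 0

end SourceCode

/-- A nonnegative rate tuple is achievable if for each `ε > 0` there are source codes of arbitrarily
large (positive) length with error probability at most `ε` and rates at most `r l + ε`. -/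
def IsAchievableRate {L : ℕ} {W : Fin L → Type*} [∀ l, Fintype (W l)]
    (p : PMF (∀ l, W l)) (r : Fin L → ℝ) : Prop :=
  (∀ l, 0 ≤ r l) ∧
    ∀ ε : ℝ, 0 < ε → ∀ N : ℕ, ∃ n : ℕ, N < n ∧ ∃ C : SourceCode W n,
      C.errorProb p ≤ ε ∧ ∀ l, C.rate l ≤ r l + ε

/-- The source-coding rate region: the set of all achievable rate tuples. -/
def sourceCodingRegion {L : ℕ} {W : Fin L → Type*} [∀ l, Fintype (W l)]
    (p : PMF (∀ l, W l)) : Set (Fin L → ℝ) :=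
  {r | IsAchievableRate p r}

end

/-!
The statement is the Slepian–Wolf theorem for several sources, with every node acting as a receiver
that has its own source as side information. Both inclusions rest on one elementary form of the
asymptotic equipartition property: writing `f` for the projection of a letter to the components
outside `S`, the conditional probability of an i.i.d. block given its image under `f` is
`2 ^ (-∑ i, surprisal (wᵢ))`, and by Chebyshev's inequality the exponent is close to
`n * H(W_S | W_{Sᶜ})` except on a set of vanishing probability (`sum_blockProb_deviation_le`,
`blockProb_eq_rpow_mul`).

*Converse.* A node outside `S` decodes correctly only if the block is determined by its components
outside `S` and the messages from `S` (`SourceCode.injOn_correctSet`). So for given components outside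
`S` at most `∏ l ∈ S, M l` blocks are decoded correctly, and typical ones have conditional probability
at most `2 ^ (-n (H - δ))`; hence the probability of correct decoding tends to zero unless the rates
in `S` sum to at least `H` (`sum_blockProb_le_of_injOn`). This counting bound replaces Fano's
inequality.

*Achievability.* Random binning: average over all families of compressors, with each decompressor
looking for a typical block compatible with what it knows. Two blocks that differ exactly at the nodes
in `S` collide with probability at most `∏ k ∈ S, 1 / M k` (`card_collide_mul_le`), and there are at
most `2 ^ (n (H(W_S | W_{Sᶜ}) + δ))` typical blocks of that kind (`card_typicalSet_diffSet_le`). The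
decoding node never belongs to `S`, which is why only strict subsets constrain the rates.
-/

/-! ### Memoryless blocks and Chebyshev's inequality -/

section Block

variable {V : Type*} {n : ℕ}

/-- The probability of the block `w` when its letters are drawn independently with weights `P`. -/
def blockProb (P : V → ℝ) (w : Fin n → V) : ℝ := ∏ i, P (w i)

lemma blockProb_nonneg {P : V → ℝ} (hP : ∀ v, 0 ≤ P v) (w : Fin n → V) : 0 ≤ blockProb P w :=
  Finset.prod_nonneg fun i _ => hP (w i)

lemma sum_blockProb [Fintype V] {P : V → ℝ} (hP : ∑ v, P v = 1) :
    ∑ w : Fin n → V, blockProb P w = 1 := by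
  classical
  have h := Finset.prod_univ_sum (fun _ : Fin n => (Finset.univ : Finset V)) fun _ v => P v
  simp only [hP, Finset.prod_const_one, Fintype.piFinset_univ] at h
  exact h.symm

lemma sum_block_succ [Fintype V] (g : (Fin (n + 1) → V) → ℝ) :
    ∑ w, g w = ∑ v, ∑ w : Fin n → V, g (Fin.cons v w) := by
  rw [← (Fin.consEquiv fun _ : Fin (n + 1) => V).sum_comp, Fintype.sum_prod_type]
  rfl

lemma blockProb_cons (P : V → ℝ) (v : V) (w : Fin n → V) :
    blockProb P (Fin.cons v w : Fin (n + 1) → V) = P v * blockProb P w := by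
  simp [blockProb, Fin.prod_univ_succ]

lemma sum_blockProb_mul_sum [Fintype V] {P X : V → ℝ} (hP : ∑ v, P v = 1)
    (hX : ∑ v, P v * X v = 0) (n : ℕ) :
    ∑ w : Fin n → V, blockProb P w * ∑ i, X (w i) = 0 := by
  induction n with
  | zero => simp
  | succ n ih =>
    rw [sum_block_succ]
    have h (v : V) : ∑ w : Fin n → V, blockProb P (Fin.cons v w : Fin (n + 1) → V) *
        ∑ i, X ((Fin.cons v w : Fin (n + 1) → V) i) = P v * X v := by
      calc _ = ∑ w : Fin n → V, (P v * X v * blockProb P w +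
              P v * (blockProb P w * ∑ i, X (w i))) := by
            refine Finset.sum_congr rfl fun w _ => ?_
            simp only [blockProb_cons, Fin.sum_univ_succ, Fin.cons_zero, Fin.cons_succ]
            ring
        _ = _ := by
            rw [Finset.sum_add_distrib, ← Finset.mul_sum, ← Finset.mul_sum, ih, sum_blockProb hP]
            ring
    simp only [h, hX]

lemma sum_blockProb_mul_sum_sq [Fintype V] {P X : V → ℝ} (hP : ∑ v, P v = 1)
    (hX : ∑ v, P v * X v = 0) (n : ℕ) :
    ∑ w : Fin n → V, blockProb P w * (∑ i, X (w i)) ^ 2 = n * ∑ v, P v * X v ^ 2 := by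
  induction n with
  | zero => simp
  | succ n ih =>
    rw [sum_block_succ]
    have h (v : V) : ∑ w : Fin n → V, blockProb P (Fin.cons v w : Fin (n + 1) → V) *
        (∑ i, X ((Fin.cons v w : Fin (n + 1) → V) i)) ^ 2 =
          P v * X v ^ 2 + P v * (n * ∑ v, P v * X v ^ 2) := by
      calc _ = ∑ w : Fin n → V, (P v * X v ^ 2 * blockProb P w +
              2 * P v * X v * (blockProb P w * ∑ i, X (w i)) +
              P v * (blockProb P w * (∑ i, X (w i)) ^ 2)) := by
            refine Finset.sum_congr rfl fun w _ => ?_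
            simp only [blockProb_cons, Fin.sum_univ_succ, Fin.cons_zero, Fin.cons_succ]
            ring
        _ = _ := by
            rw [Finset.sum_add_distrib, Finset.sum_add_distrib, ← Finset.mul_sum, ← Finset.mul_sum,
              ← Finset.mul_sum, ih, sum_blockProb hP, sum_blockProb_mul_sum hP hX]
            ring
    simp only [h]
    rw [Finset.sum_add_distrib, ← Finset.sum_mul, hP]
    push_cast
    ring

open scoped Classical in
/-- **Chebyshev's inequality** for the empirical sum of a function `X` with mean `m` along a
memoryless block. -/
lemma sum_blockProb_deviation_le [Fintype V] {P : V → ℝ} (hP0 : ∀ v, 0 ≤ P v)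
    (hP : ∑ v, P v = 1) {X : V → ℝ} {m : ℝ} (hX : ∑ v, P v * X v = m) (hn : 0 < n) {δ : ℝ}
    (hδ : 0 < δ) :
    ∑ w : Fin n → V with n * δ ≤ |∑ i, X (w i) - n * m|, blockProb P w ≤
      (∑ v, P v * (X v - m) ^ 2) / (n * δ ^ 2) := by
  have hn' : (0 : ℝ) < n := by exact_mod_cast hn
  have hX' : ∑ v, P v * (X v - m) = 0 := by
    simp only [mul_sub, Finset.sum_sub_distrib, ← Finset.sum_mul, hX, hP]
    ring
  have h2 := sum_blockProb_mul_sum_sq hP hX' n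
  rw [le_div_iff₀ (by positivity), Finset.sum_mul]
  refine le_of_mul_le_mul_left ?_ hn'
  rw [← h2, Finset.mul_sum, Finset.sum_filter]
  refine Finset.sum_le_sum fun w _ => ?_
  have h0 := blockProb_nonneg hP0 w
  split_ifs with hw
  · have h3 : (n * δ) ^ 2 ≤ (∑ i, (X (w i) - m)) ^ 2 := by
      rw [← sq_abs (∑ i, _)]
      refine pow_le_pow_left₀ (by positivity) ?_ 2
      simpa [Finset.sum_sub_distrib] using hw
    calc _ = blockProb P w * (n * δ) ^ 2 := by ring
      _ ≤ _ := by gcongr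
  · positivity

end Block

/-! ### Conditional entropy given a function of the letter -/

section Entropy

variable {V B : Type*} [Fintype V] {n : ℕ}

open scoped Classical in
/-- The probability that a letter drawn with weights `P` has the value `b` under `f`. -/
noncomputable def fiberMass (f : V → B) (P : V → ℝ) (b : B) : ℝ := ∑ v with f v = b, P v

/-- The conditional information content `-log₂ ℙ(v | f v)` of the letter `v` given its value under
`f`. -/
noncomputable def surprisal (f : V → B) (P : V → ℝ) (v : V) : ℝ :=
  -Real.logb 2 (P v / fiberMass f P (f v))

/-- The conditional entropy in bits of a letter with weights `P` given its value under `f`. -/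
noncomputable def fiberEntropy (f : V → B) (P : V → ℝ) : ℝ := ∑ v, P v * surprisal f P v

lemma fiberMass_nonneg (f : V → B) {P : V → ℝ} (hP : ∀ v, 0 ≤ P v) (b : B) :
    0 ≤ fiberMass f P b :=
  Finset.sum_nonneg fun v _ => hP v

lemma le_fiberMass (f : V → B) {P : V → ℝ} (hP : ∀ v, 0 ≤ P v) (v : V) :
    P v ≤ fiberMass f P (f v) := by
  classical
  exact Finset.single_le_sum (fun v _ => hP v) (by simp)

lemma sum_fiberMass [Fintype B] (f : V → B) (P : V → ℝ) : ∑ b, fiberMass f P b = ∑ v, P v := by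
  classical
  exact Finset.sum_fiberwise_of_maps_to (fun _ _ => Finset.mem_univ _) P

lemma sum_blockProb_le_of_fiber (f : V → B) {P : V → ℝ} (hP : ∀ v, 0 ≤ P v) {y : Fin n → B}
    {s : Finset (Fin n → V)} (hs : ∀ w ∈ s, ∀ i, f (w i) = y i) :
    ∑ w ∈ s, blockProb P w ≤ blockProb (fiberMass f P) y := by
  unfold blockProb fiberMass
  rw [Finset.prod_univ_sum]
  refine Finset.sum_le_sum_of_subset_of_nonneg (fun w hw => ?_)
    fun w _ _ => blockProb_nonneg hP w
  simpa [Fintype.mem_piFinset] using hs w hw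

/-- The conditional probability of a block given its letterwise image under `f` is determined by its
total surprisal. Positivity is needed since `surprisal` has the junk value `0` at letters of
probability zero. -/
lemma blockProb_eq_rpow_mul (f : V → B) {P : V → ℝ} (hP : ∀ v, 0 ≤ P v) {w : Fin n → V}
    (hw : 0 < blockProb P w) :
    blockProb P w =
      (2 : ℝ) ^ (-∑ i, surprisal f P (w i)) * blockProb (fiberMass f P) fun i => f (w i) := by
  have h (i : Fin n) : 0 < P (w i) :=
    (hP _).lt_of_ne' fun h => hw.ne' (Finset.prod_eq_zero (Finset.mem_univ i) h)
  rw [← Finset.sum_neg_distrib, Real.rpow_sum_of_pos two_pos, blockProb, blockProb,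
    ← Finset.prod_mul_distrib]
  refine Finset.prod_congr rfl fun i _ => ?_
  have hm := (h i).trans_le (le_fiberMass f hP (w i))
  rw [surprisal, neg_neg, Real.rpow_logb two_pos (by norm_num) (div_pos (h i) hm),
    div_mul_cancel₀ _ hm.ne']

end Entropy

/-! ### The conditional entropies of the source -/

section Source

variable {L : ℕ} {W : Fin L → Type*} [∀ l, Fintype (W l)]

lemma sum_toReal_pmf {V : Type*} [Fintype V] (p : PMF V) : ∑ v, (p v).toReal = 1 := by
  rw [← ENNReal.toReal_sum fun v _ => p.apply_ne_top v, ← tsum_fintype (L := .unconditional V),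
    p.tsum_coe, ENNReal.toReal_one]

lemma toReal_map_pmf {V B : Type*} [Fintype V] (f : V → B) (p : PMF V) (b : B) :
    (p.map f b).toReal = fiberMass f (fun v => (p v).toReal) b := by
  classical
  rw [PMF.map_apply, tsum_fintype, fiberMass, ENNReal.toReal_sum, Finset.sum_filter]
  · refine Finset.sum_congr rfl fun v _ => ?_
    by_cases h : f v = b
    · simp [h]
    · simp [h, Ne.symm h]
  · intro v _
    split_ifs
    exacts [p.apply_ne_top v, ENNReal.zero_ne_top]

/-- Splitting a letter into its components in `S` and those outside `S`. -/
def splitEquiv (W : Fin L → Type*) (S : Finset (Fin L)) :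
    (∀ l, W l) ≃ (∀ l : S, W l) × (∀ l : ↥Sᶜ, W l) where
  toFun w := (S.restrict w, Sᶜ.restrict w)
  invFun x l := if h : l ∈ S then x.1 ⟨l, h⟩ else x.2 ⟨l, Finset.mem_compl.2 h⟩
  left_inv w := by
    funext l
    by_cases h : l ∈ S <;> simp [h]
  right_inv x := by
    refine Prod.ext ?_ ?_
    · funext l
      simp
    · funext l
      have := Finset.mem_compl.1 l.2
      simp [this]

lemma sourceCondEntropy_eq_fiberEntropy (p : PMF (∀ l, W l)) (S : Finset (Fin L)) :
    sourceCondEntropy p S =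
      fiberEntropy (fun w => Sᶜ.restrict w) fun v => (p v).toReal := by
  classical
  rw [sourceCondEntropy, condEntropy, fiberEntropy, ← Fintype.sum_prod_type',
    ← (splitEquiv W S).sum_comp, ← Finset.sum_neg_distrib]
  refine Finset.sum_congr rfl fun w _ => ?_
  have h : p.map (fun w => (S.restrict w, Sᶜ.restrict w)) (splitEquiv W S w) = p w := by
    change p.map (splitEquiv W S) _ = _
    rw [PMF.map_apply, tsum_eq_single w]
    · simp
    · intro v hv
      simp [hv.symm]
  rw [surprisal, PMF.map_comp, ← toReal_map_pmf, mul_neg]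
  change -((p.map _ (splitEquiv W S w)).toReal *
    Real.logb 2 ((p.map _ (splitEquiv W S w)).toReal / _)) = _
  rw [h]
  rfl

end Source

/-! ### Converse -/

open Filter Topology in
lemma eventually_div_mul_lt (c : ℝ) {d ε : ℝ} (hd : 0 < d) (hε : 0 < ε) :
    ∀ᶠ n : ℕ in atTop, c / (n * d) < ε := by
  have h : Tendsto (fun n : ℕ => c / (n * d)) atTop (𝓝 0) :=
    tendsto_const_nhds.div_atTop (tendsto_natCast_atTop_atTop.atTop_mul_const hd)
  exact h.eventually_lt_const hε

open Filter Topology in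
lemma eventually_two_rpow_neg_lt {a ε : ℝ} (ha : 0 < a) (hε : 0 < ε) :
    ∀ᶠ n : ℕ in atTop, (2 : ℝ) ^ (-(n * a)) < ε := by
  have h : Tendsto (fun n : ℕ => ((2 : ℝ) ^ (-a)) ^ n) atTop (𝓝 0) :=
    tendsto_pow_atTop_nhds_zero_of_lt_one (by positivity)
      (Real.rpow_lt_one_of_one_lt_of_neg one_lt_two (neg_neg_of_pos ha))
  filter_upwards [h.eventually_lt_const hε] with n hn
  rwa [← Real.rpow_mul_natCast two_pos.le, neg_mul, mul_comm] at hn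

section Converse

/-- If the blocks in `G` can be recovered from their letterwise image under `f` together with a
message `m`, then `G` has small probability unless there are about `2 ^ (n * H)` messages, `H` being
the entropy of a letter given its image under `f`. -/
lemma sum_blockProb_le_of_injOn {V B K : Type*} [Fintype V] [Fintype B] [Fintype K] {n : ℕ}
    {P : V → ℝ} (hP0 : ∀ v, 0 ≤ P v) (hP : ∑ v, P v = 1) (f : V → B) (hn : 0 < n) {δ : ℝ}
    (hδ : 0 < δ) (G : Finset (Fin n → V)) (m : (Fin n → V) → K)
    (hG : Set.InjOn (fun w => ((fun i => f (w i) : Fin n → B), m w)) G) :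
    ∑ w ∈ G, blockProb P w ≤
      (∑ v, P v * (surprisal f P v - fiberEntropy f P) ^ 2) / (n * δ ^ 2) +
        Fintype.card K * (2 : ℝ) ^ (-(n * (fiberEntropy f P - δ))) := by
  classical
  have hC := sum_blockProb_deviation_le hP0 hP (X := surprisal f P) (m := fiberEntropy f P) rfl hn hδ
  set H := fiberEntropy f P with hH
  have hμ0 := fiberMass_nonneg f hP0
  have hμ : ∑ y, fiberMass f P y = 1 := (sum_fiberMass f P).trans hP
  have h1 (w : Fin n → V) : blockProb P w ≤
      (if n * δ ≤ |∑ i, surprisal f P (w i) - n * H| then blockProb P w else 0) +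
        (2 : ℝ) ^ (-(n * (H - δ))) * blockProb (fiberMass f P) fun i => f (w i) := by
    have h0 : 0 ≤ (2 : ℝ) ^ (-(n * (H - δ))) * blockProb (fiberMass f P) fun i => f (w i) :=
      mul_nonneg (by positivity) (blockProb_nonneg hμ0 _)
    split_ifs with h
    · linarith
    · rcases (blockProb_nonneg hP0 w).eq_or_lt with h' | h'
      · rw [← h', zero_add]
        exact h0
      · rw [zero_add, blockProb_eq_rpow_mul f hP0 h']
        refine mul_le_mul_of_nonneg_right ?_ (blockProb_nonneg hμ0 _)
        refine Real.rpow_le_rpow_of_exponent_le one_le_two ?_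
        have := (abs_lt.1 (not_le.1 h)).1
        linarith
  have h2 : ∑ w ∈ G, blockProb (fiberMass f P) (fun i => f (w i)) ≤ Fintype.card K := by
    calc ∑ w ∈ G, blockProb (fiberMass f P) (fun i => f (w i))
        = ∑ x ∈ G.image fun w => ((fun i => f (w i) : Fin n → B), m w),
            blockProb (fiberMass f P) x.1 := by rw [Finset.sum_image hG]
      _ ≤ ∑ x : (Fin n → B) × K, blockProb (fiberMass f P) x.1 :=
          Finset.sum_le_sum_of_subset_of_nonneg (Finset.subset_univ _)
            fun x _ _ => blockProb_nonneg hμ0 _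
      _ = Fintype.card K := by
          rw [Fintype.sum_prod_type_right]
          simp [sum_blockProb hμ]
  calc ∑ w ∈ G, blockProb P w ≤ ∑ w ∈ G,
        ((if n * δ ≤ |∑ i, surprisal f P (w i) - n * H| then blockProb P w else 0) +
        (2 : ℝ) ^ (-(n * (H - δ))) * blockProb (fiberMass f P) fun i => f (w i)) :=
        Finset.sum_le_sum fun w _ => h1 w
    _ ≤ _ := by
        rw [Finset.sum_add_distrib, ← Finset.mul_sum, mul_comm (Fintype.card K : ℝ)]
        refine add_le_add (le_trans ?_ hC) (mul_le_mul_of_nonneg_left h2 (by positivity))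
        rw [Finset.sum_filter]
        refine Finset.sum_le_sum_of_subset_of_nonneg (Finset.subset_univ _) fun w _ _ => ?_
        split_ifs
        exacts [blockProb_nonneg hP0 w, le_rfl]

variable {L : ℕ} {W : Fin L → Type*} {n : ℕ}

open scoped Classical in
/-- The source blocks that every node reconstructs correctly. -/
noncomputable def SourceCode.correctSet [∀ l, Fintype (W l)] (C : SourceCode W n) :
    Finset (Fin n → ∀ k, W k) :=
  {w | ∀ l, C.estimate w l = fun k i => w i k}

lemma SourceCode.sum_correctSet [∀ l, Fintype (W l)] (C : SourceCode W n) (p : PMF (∀ l, W l)) :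
    ∑ w ∈ C.correctSet, blockProb (fun v => (p v).toReal) w = 1 - C.errorProb p := by
  classical
  rw [eq_sub_iff_add_eq, ← sum_blockProb (n := n) (sum_toReal_pmf p), correctSet,
    Finset.sum_filter, errorProb, ← Finset.sum_add_distrib]
  refine Finset.sum_congr rfl fun w _ => ?_
  by_cases h : ∀ l, C.estimate w l = fun k i => w i k
  · simp [h]
  · rw [if_neg h, if_pos (not_forall.1 h), zero_add, blockProb]

/-- A node outside `S` recovers the block from the components outside `S`, which include its own
side information and determine their messages, and the messages of the nodes in `S`. -/
lemma SourceCode.injOn_correctSet [∀ l, Fintype (W l)] (C : SourceCode W n) {S : Finset (Fin L)}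
    (hS : S ≠ Finset.univ) :
    Set.InjOn (fun w : Fin n → ∀ k, W k =>
      ((fun i => Sᶜ.restrict (w i) : Fin n → ∀ l : ↥Sᶜ, W l),
        (fun k : S => C.enc k fun i => w i k))) C.correctSet := by
  classical
  obtain ⟨l, hl⟩ : ∃ l, l ∉ S := by
    simpa [Finset.eq_univ_iff_forall] using hS
  intro w hw w' hw' h
  simp only [Prod.mk.injEq, funext_iff] at h
  have hx (k : Fin L) (hk : k ∉ S) : (fun i => w i k) = fun i => w' i k :=
    funext fun i => h.1 i ⟨k, Finset.mem_compl.2 hk⟩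
  have hm : (fun k => C.enc k fun i => w i k) = fun k => C.enc k fun i => w' i k := by
    funext k
    by_cases hk : k ∈ S
    · exact h.2 ⟨k, hk⟩
    · rw [hx k hk]
  simp only [correctSet, Finset.coe_filter, Finset.mem_univ, true_and, Set.mem_ofPred_eq] at hw hw'
  have he : C.estimate w l = C.estimate w' l := by
    rw [estimate, estimate, hx l hl, hm]
  rw [hw, hw'] at he
  funext i k
  exact congrFun (congrFun he k) i

lemma SourceCode.natCast_M (C : SourceCode W n) (hn : 0 < n) (l : Fin L) (hM : 0 < C.M l) :
    (C.M l : ℝ) = 2 ^ (n * C.rate l) := by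
  have hn' : (n : ℝ) ≠ 0 := by exact_mod_cast hn.ne'
  rw [rate, ← mul_assoc, mul_one_div_cancel hn', one_mul,
    Real.rpow_logb two_pos (by norm_num) (by exact_mod_cast hM)]

theorem sourceCondEntropy_le_of_isAchievableRate [∀ l, Fintype (W l)] {p : PMF (∀ l, W l)}
    {r : Fin L → ℝ} (h : IsAchievableRate p r) {S : Finset (Fin L)} (hS : S ≠ Finset.univ) :
    sourceCondEntropy p S ≤ ∑ l ∈ S, r l := by
  classical
  rw [sourceCondEntropy_eq_fiberEntropy]
  set P : (∀ l, W l) → ℝ := fun v => (p v).toReal with hPdef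
  have hP0 : ∀ v, 0 ≤ P v := fun v => ENNReal.toReal_nonneg
  have hP := sum_toReal_pmf p
  set f : (∀ l, W l) → ∀ l : ↥Sᶜ, W l := fun w => Sᶜ.restrict w with hf
  set H := fiberEntropy f P with hH
  by_contra! hlt
  set g := H - ∑ l ∈ S, r l with hg
  have hg0 : 0 < g := sub_pos.2 hlt
  set c := ∑ v, P v * (surprisal f P v - H) ^ 2 with hc
  obtain ⟨N, hN⟩ := Filter.eventually_atTop.1
    ((eventually_div_mul_lt c (d := (g / 4) ^ 2) (ε := 1 / 4) (by positivity) (by norm_num)).and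
      (eventually_two_rpow_neg_lt (a := g / 2) (ε := 1 / 4) (by positivity) (by norm_num)))
  -- the rate excess of `S` is at most `g / 4`, and errors have probability at most `1 / 4`
  have hε : 0 < min (1 / 4) (g / (4 * (L + 1))) := by positivity
  obtain ⟨n, hNn, C, hCe, hCr⟩ := h.2 _ hε N
  have hn : 0 < n := (Nat.zero_le N).trans_lt hNn
  obtain ⟨hN1, hN2⟩ := hN n hNn.le
  have hmain := sum_blockProb_le_of_injOn hP0 hP f hn (δ := g / 4) (by positivity) C.correctSet _
    (C.injOn_correctSet hS)
  rw [C.sum_correctSet p, ← hH, ← hc] at hmain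
  -- a compressor can only exist if its message set is nonempty, so no `logb 2 0` occurs in the rates
  have : Nonempty (∀ l, W l) := ⟨p.support_nonempty.some⟩
  have hM (l : Fin L) : 0 < C.M l :=
    Fin.pos (C.enc l fun _ => Classical.arbitrary (∀ l, W l) l)
  have hK : (Fintype.card (∀ k : S, Fin (C.M k)) : ℝ) = 2 ^ (n * ∑ l ∈ S, C.rate l) := by
    rw [Fintype.card_pi, Finset.mul_sum, Real.rpow_sum_of_pos two_pos,
      ← Finset.prod_coe_sort S fun l => (2 : ℝ) ^ (n * C.rate l)]
    push_cast
    refine Finset.prod_congr rfl fun l _ => ?_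
    rw [Fintype.card_fin, C.natCast_M hn l (hM l)]
  have hsum : ∑ l ∈ S, C.rate l ≤ ∑ l ∈ S, r l + g / 4 := by
    calc ∑ l ∈ S, C.rate l ≤ ∑ l ∈ S, (r l + g / (4 * (L + 1))) :=
          Finset.sum_le_sum fun l _ => (hCr l).trans (by gcongr; exact min_le_right _ _)
      _ = ∑ l ∈ S, r l + S.card * (g / (4 * (L + 1))) := by
          rw [Finset.sum_add_distrib, Finset.sum_const, nsmul_eq_mul]
      _ ≤ ∑ l ∈ S, r l + (L + 1) * (g / (4 * (L + 1))) := by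
          have : (S.card : ℝ) ≤ L := by exact_mod_cast S.card_le_univ.trans_eq (Fintype.card_fin L)
          gcongr
          linarith
      _ = _ := by
          field_simp
  have hbound : (Fintype.card (∀ k : S, Fin (C.M k)) : ℝ) * 2 ^ (-(n * (H - g / 4))) ≤
      2 ^ (-(n * (g / 2))) := by
    rw [hK, ← Real.rpow_add two_pos]
    refine Real.rpow_le_rpow_of_exponent_le one_le_two ?_
    have : (n : ℝ) * ∑ l ∈ S, C.rate l ≤ n * (∑ l ∈ S, r l + g / 4) := by gcongr
    have h' : H = g + ∑ l ∈ S, r l := by rw [hg]; ring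
    rw [h']
    linarith
  have := hCe.trans (min_le_left _ _)
  linarith

end Converse

/-! ### Achievability by random binning -/

section Achievability

/-- A uniformly random function takes the same value at two distinct points with probability at most
`1 / M`: overwriting the value at `a` by an arbitrary one loses no information, as it equals the
value at `b`. -/
lemma card_apply_eq_mul_le {A : Type*} [Fintype A] [DecidableEq A] {M : ℕ} {a b : A} (hab : a ≠ b) :
    (Finset.univ.filter fun f : A → Fin M => f a = f b).card * M ≤ Fintype.card (A → Fin M) := by
  rw [← Fintype.card_subtype]
  refine le_of_eq_of_le (by rw [Fintype.card_prod, Fintype.card_fin]) (Fintype.card_le_of_injective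
    (fun x : {f : A → Fin M // f a = f b} × Fin M => Function.update x.1.1 a x.2) ?_)
  rintro ⟨⟨f, hf⟩, c⟩ ⟨⟨g, hg⟩, d⟩ h
  have h' (z : A) : Function.update f a c z = Function.update g a d z := congrFun h z
  have hne (z : A) (hz : z ≠ a) : f z = g z := by simpa [hz] using h' z
  have hcd : c = d := by simpa using h' a
  have hfg : f = g := by
    funext z
    by_cases hz : z = a
    · rw [hz, hf, hg, hne b hab.symm]
    · exact hne z hz
  subst hcd hfg
  rfl

variable {L : ℕ} {W : Fin L → Type*} [∀ l, Fintype (W l)] {n : ℕ}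

open scoped Classical in
/-- The nodes at which two source blocks differ. -/
noncomputable def diffSet (w w' : Fin n → ∀ k, W k) : Finset (Fin L) :=
  {k | (fun i => w' i k) ≠ fun i => w i k}

/-- The compressors `F` give the same messages for the source blocks `w` and `w'`. -/
def Collide {M : Fin L → ℕ} (F : ∀ l, (Fin n → W l) → Fin (M l)) (w w' : Fin n → ∀ k, W k) :
    Prop :=
  ∀ k, F k (fun i => w' i k) = F k fun i => w i k

open scoped Classical in
/-- Two source blocks collide under uniformly random compressors with probability at most the
product of `1 / M k` over the nodes at which they differ. -/
lemma card_collide_mul_le (M : Fin L → ℕ) (w w' : Fin n → ∀ k, W k) :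
    (Finset.univ.filter fun F : ∀ l, (Fin n → W l) → Fin (M l) => Collide F w w').card *
      ∏ k ∈ diffSet w w', M k ≤ Fintype.card (∀ l, (Fin n → W l) → Fin (M l)) := by
  have h : (Finset.univ.filter fun F : ∀ l, (Fin n → W l) → Fin (M l) => Collide F w w') =
      Fintype.piFinset fun k => Finset.univ.filter fun f : (Fin n → W k) → Fin (M k) =>
        f (fun i => w' i k) = f fun i => w i k := by
    ext F
    rw [Finset.mem_filter, Fintype.mem_piFinset]
    simp [Collide]
  rw [h, Fintype.card_piFinset, diffSet, Finset.prod_filter, ← Finset.prod_mul_distrib,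
    Fintype.card_pi]
  refine Finset.prod_le_prod' fun k _ => ?_
  split_ifs with hk
  · exact card_apply_eq_mul_le hk
  · rw [mul_one]
    exact Finset.card_le_univ _

open scoped Classical in
/-- The code with compressors `F` whose decompressor at each node outputs some block of `T` that is
compatible with the node's own source string and with all messages, if there is one. -/
noncomputable def binningCode [Nonempty (∀ k, W k)] (T : Finset (Fin n → ∀ k, W k))
    {M : Fin L → ℕ} (F : ∀ l, (Fin n → W l) → Fin (M l)) : SourceCode W n where
  M := M
  enc := F
  dec l x m :=
    if h : ∃ w ∈ T, (fun i => w i l) = x ∧ ∀ k, F k (fun i => w i k) = m k then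
      fun k i => h.choose i k
    else fun k _ => Classical.arbitrary (∀ k, W k) k

omit [∀ l, Fintype (W l)] in
lemma exists_collide_of_estimate_ne [Nonempty (∀ k, W k)] {T : Finset (Fin n → ∀ k, W k)}
    {M : Fin L → ℕ} {F : ∀ l, (Fin n → W l) → Fin (M l)} {w : Fin n → ∀ k, W k} (hw : w ∈ T)
    {l : Fin L} (h : (binningCode T F).estimate w l ≠ fun k i => w i k) :
    ∃ w' ∈ T, (diffSet w w').Nonempty ∧ diffSet w w' ≠ Finset.univ ∧ Collide F w w' := by
  classical
  have hex : ∃ w' ∈ T, (fun i => w' i l) = (fun i => w i l) ∧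
      ∀ k, F k (fun i => w' i k) = F k fun i => w i k := ⟨w, hw, rfl, fun _ => rfl⟩
  have he : (binningCode T F).estimate w l = fun k i => hex.choose i k := by
    simp only [SourceCode.estimate, binningCode]
    exact dif_pos hex
  obtain ⟨hT, hl, hF⟩ := hex.choose_spec
  refine ⟨hex.choose, hT, ?_, ?_, hF⟩
  · rw [he] at h
    obtain ⟨k, hk⟩ := Function.ne_iff.1 h
    exact ⟨k, by simpa [diffSet] using hk⟩
  · intro hu
    have : l ∈ diffSet w hex.choose := hu ▸ Finset.mem_univ l
    simp only [diffSet, Finset.mem_filter] at this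
    exact this.2 hl

open scoped Classical in
/-- Union bound for the error probability of a binning code: an error occurs only if the block is
outside `T` or collides with another block of `T`; the latter are sorted by the set of nodes at which
they differ, which is not everything since the decoding node knows its own string. -/
lemma errorProb_binningCode_le [Nonempty (∀ k, W k)] (p : PMF (∀ l, W l))
    (T : Finset (Fin n → ∀ k, W k)) {M : Fin L → ℕ} (F : ∀ l, (Fin n → W l) → Fin (M l)) :
    (binningCode T F).errorProb p ≤
      ∑ w ∈ Tᶜ, blockProb (fun v => (p v).toReal) w +
        ∑ w ∈ T, blockProb (fun v => (p v).toReal) w *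
          ∑ S : Finset (Fin L) with S.Nonempty ∧ S ≠ Finset.univ,
            ∑ w' ∈ T with diffSet w w' = S, if Collide F w w' then (1 : ℝ) else 0 := by
  have h0 (w : Fin n → ∀ k, W k) : 0 ≤ blockProb (fun v => (p v).toReal) w :=
    blockProb_nonneg (fun v => ENNReal.toReal_nonneg) w
  rw [SourceCode.errorProb, ← Finset.sum_add_sum_compl T, add_comm]
  refine add_le_add (Finset.sum_le_sum fun w _ => ?_) (Finset.sum_le_sum fun w hw => ?_)
  · split_ifs
    exacts [le_rfl, h0 w]
  · have hin (S : Finset (Fin L)) :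
        0 ≤ ∑ w' ∈ T with diffSet w w' = S, if Collide F w w' then (1 : ℝ) else 0 :=
      Finset.sum_nonneg fun _ _ => by split_ifs <;> norm_num
    split_ifs with h
    · obtain ⟨l, hl⟩ := h
      obtain ⟨w', hT, h1, h2, hc⟩ := exists_collide_of_estimate_ne hw hl
      refine le_mul_of_one_le_right (h0 w) ?_
      calc (1 : ℝ) = if Collide F w w' then 1 else 0 := (if_pos hc).symm
        _ ≤ ∑ w'' ∈ T with diffSet w w'' = diffSet w w', if Collide F w w'' then (1 : ℝ) else 0 :=
            Finset.single_le_sum (f := fun w'' => if Collide F w w'' then (1 : ℝ) else 0)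
              (fun _ _ => by split_ifs <;> norm_num) (by simp [hT])
        _ ≤ _ := Finset.single_le_sum (f := fun S => ∑ w' ∈ T with diffSet w w' = S,
              if Collide F w w' then (1 : ℝ) else 0) (fun S _ => hin S) (by simp [h1, h2])
    · exact mul_nonneg (h0 w) (Finset.sum_nonneg fun S _ => hin S)

open scoped Classical in
/-- Averaging over all compressors: some binning code has an error probability at most the
probability of leaving `T` plus the expected number of collisions within `T`. -/
lemma exists_binningCode_errorProb_le [Nonempty (∀ k, W k)] (p : PMF (∀ l, W l))
    (T : Finset (Fin n → ∀ k, W k)) {M : Fin L → ℕ} (hM : ∀ l, 0 < M l) {K : Finset (Fin L) → ℝ}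
    (hK0 : ∀ S, 0 ≤ K S)
    (hK : ∀ S, ∀ w ∈ T, ((T.filter fun w' => diffSet w w' = S).card : ℝ) ≤ K S) :
    ∃ F : ∀ l, (Fin n → W l) → Fin (M l), (binningCode T F).errorProb p ≤
      ∑ w ∈ Tᶜ, blockProb (fun v => (p v).toReal) w +
        ∑ S : Finset (Fin L) with S.Nonempty ∧ S ≠ Finset.univ, K S / ∏ k ∈ S, (M k : ℝ) := by
  set P : (∀ l, W l) → ℝ := fun v => (p v).toReal with hPdef
  have hP0 : ∀ v, 0 ≤ P v := fun v => ENNReal.toReal_nonneg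
  have hP : ∑ v, P v = 1 := sum_toReal_pmf p
  set E := ∀ l, (Fin n → W l) → Fin (M l) with hE
  have : Nonempty E := ⟨fun l _ => ⟨0, hM l⟩⟩
  have hMS (S : Finset (Fin L)) : (0 : ℝ) < ∏ k ∈ S, (M k : ℝ) :=
    Finset.prod_pos fun k _ => by exact_mod_cast hM k
  set R := ∑ S : Finset (Fin L) with S.Nonempty ∧ S ≠ Finset.univ, K S / ∏ k ∈ S, (M k : ℝ) with hR
  -- the expected number of collisions of a given block of `T`
  have hcol (w : Fin n → ∀ k, W k) (hw : w ∈ T) :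
      ∑ F : E, ∑ S : Finset (Fin L) with S.Nonempty ∧ S ≠ Finset.univ,
        ∑ w' ∈ T with diffSet w w' = S, (if Collide F w w' then (1 : ℝ) else 0) ≤
          Fintype.card E * R := by
    rw [Finset.sum_comm, hR, Finset.mul_sum]
    refine Finset.sum_le_sum fun S _ => ?_
    rw [Finset.sum_comm]
    calc ∑ w' ∈ T with diffSet w w' = S, ∑ F : E, (if Collide F w w' then (1 : ℝ) else 0)
        ≤ ∑ w' ∈ T with diffSet w w' = S, Fintype.card E / ∏ k ∈ S, (M k : ℝ) := by
          refine Finset.sum_le_sum fun w' hw' => ?_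
          rw [Finset.sum_boole, le_div_iff₀ (hMS S)]
          have := card_collide_mul_le M w w'
          rw [(Finset.mem_filter.1 hw').2] at this
          exact_mod_cast this
      _ = (T.filter fun w' => diffSet w w' = S).card * (Fintype.card E / ∏ k ∈ S, (M k : ℝ)) := by
          rw [Finset.sum_const, nsmul_eq_mul]
      _ ≤ K S * (Fintype.card E / ∏ k ∈ S, (M k : ℝ)) :=
          mul_le_mul_of_nonneg_right (hK S w hw) (div_nonneg (Nat.cast_nonneg _) (hMS S).le)
      _ = _ := by ring
  have hT1 : ∑ w ∈ T, blockProb P w ≤ 1 := by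
    rw [← sum_blockProb (n := n) hP]
    exact Finset.sum_le_sum_of_subset_of_nonneg (Finset.subset_univ _)
      fun w _ _ => blockProb_nonneg hP0 w
  have hR0 : 0 ≤ Fintype.card E * R :=
    mul_nonneg (Nat.cast_nonneg _) (Finset.sum_nonneg fun S _ => div_nonneg (hK0 S) (hMS S).le)
  obtain ⟨F, -, hF⟩ := Finset.exists_le_of_sum_le (s := (Finset.univ : Finset E))
    (f := fun F => (binningCode T F).errorProb p)
    (g := fun _ => ∑ w ∈ Tᶜ, blockProb P w + R) Finset.univ_nonempty (by
      refine (Finset.sum_le_sum fun F _ => errorProb_binningCode_le p T F).trans ?_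
      rw [Finset.sum_add_distrib, Finset.sum_add_distrib, Finset.sum_comm (t := T)]
      refine add_le_add le_rfl ?_
      simp only [← Finset.mul_sum]
      calc _ ≤ ∑ w ∈ T, blockProb P w * (Fintype.card E * R) :=
            Finset.sum_le_sum fun w hw => mul_le_mul_of_nonneg_left (hcol w hw)
              (blockProb_nonneg hP0 w)
        _ ≤ 1 * (Fintype.card E * R) := by
            rw [← Finset.sum_mul]
            exact mul_le_mul_of_nonneg_right hT1 hR0
        _ = _ := by rw [one_mul, Finset.sum_const, Finset.card_univ, nsmul_eq_mul])
  exact ⟨F, hF⟩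

open scoped Classical in
/-- The blocks of positive probability whose conditional probability given the components outside
`S` is at least `2 ^ (-n (H(W_S | W_{Sᶜ}) + δ))`, for each `S`. -/
noncomputable def typicalSet (P : (∀ l, W l) → ℝ) (n : ℕ) (δ : ℝ) : Finset (Fin n → ∀ l, W l) :=
  {w | 0 < blockProb P w ∧ ∀ S : Finset (Fin L),
    (2 : ℝ) ^ (-(n * (fiberEntropy (fun v => Sᶜ.restrict v) P + δ))) *
      blockProb (fiberMass (fun v => Sᶜ.restrict v) P) (fun i => Sᶜ.restrict (w i)) ≤
        blockProb P w}

open scoped Classical in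
lemma sum_compl_typicalSet_le {P : (∀ l, W l) → ℝ} (hP0 : ∀ v, 0 ≤ P v) (hP : ∑ v, P v = 1)
    (hn : 0 < n) {δ : ℝ} (hδ : 0 < δ) :
    ∑ w ∈ (typicalSet P n δ)ᶜ, blockProb P w ≤
      (∑ S : Finset (Fin L), ∑ v, P v * (surprisal (fun v => Sᶜ.restrict v) P v -
        fiberEntropy (fun v => Sᶜ.restrict v) P) ^ 2) / (n * δ ^ 2) := by
  rw [Finset.sum_div]
  refine le_trans ?_ (Finset.sum_le_sum fun S _ => sum_blockProb_deviation_le hP0 hP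
    (X := surprisal (fun v => Sᶜ.restrict v) P) rfl hn hδ)
  simp only [Finset.sum_filter]
  rw [Finset.sum_comm]
  have h0 (w : Fin n → ∀ l, W l) (S : Finset (Fin L)) : 0 ≤ if n * δ ≤
      |∑ i, surprisal (fun v => Sᶜ.restrict v) P (w i) -
        n * fiberEntropy (fun v => Sᶜ.restrict v) P| then blockProb P w else 0 := by
    split_ifs
    exacts [blockProb_nonneg hP0 w, le_rfl]
  refine le_trans (Finset.sum_le_sum fun w hw => ?_)
    (Finset.sum_le_sum_of_subset_of_nonneg (Finset.subset_univ _)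
      fun w _ _ => Finset.sum_nonneg fun S _ => h0 w S)
  rcases (blockProb_nonneg hP0 w).eq_or_lt with h' | h'
  · rw [← h']
    exact Finset.sum_nonneg fun S _ => by simp
  · have hw' := Finset.mem_compl.1 hw
    simp only [typicalSet, Finset.mem_filter, Finset.mem_univ, true_and, not_and,
      not_forall] at hw'
    obtain ⟨S, hS⟩ := hw' h'
    refine le_trans (le_of_eq (if_pos ?_).symm)
      (Finset.single_le_sum (fun S _ => h0 w S) (Finset.mem_univ S))
    by_contra hlt
    have hub := (abs_lt.1 (not_le.1 hlt)).2
    refine hS ?_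
    conv_rhs => rw [blockProb_eq_rpow_mul (fun v => Sᶜ.restrict v) hP0 h']
    refine mul_le_mul_of_nonneg_right ?_ (blockProb_nonneg (fiberMass_nonneg _ hP0) _)
    refine Real.rpow_le_rpow_of_exponent_le one_le_two ?_
    linarith

open scoped Classical in
lemma card_typicalSet_diffSet_le {P : (∀ l, W l) → ℝ} (hP0 : ∀ v, 0 ≤ P v) {δ : ℝ}
    (S : Finset (Fin L)) {w : Fin n → ∀ l, W l} (hw : w ∈ typicalSet P n δ) :
    (((typicalSet P n δ).filter fun w' => diffSet w w' = S).card : ℝ) ≤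
      2 ^ (n * (fiberEntropy (fun v => Sᶜ.restrict v) P + δ)) := by
  set f : (∀ l, W l) → ∀ l : ↥Sᶜ, W l := fun v => Sᶜ.restrict v with hf
  set y : Fin n → ∀ l : ↥Sᶜ, W l := fun i => f (w i) with hy
  set μ := blockProb (fiberMass f P) y with hμ
  have hw0 : 0 < blockProb P w := (Finset.mem_filter.1 hw).2.1
  have hμ0 : 0 < μ := by
    refine (blockProb_nonneg (fiberMass_nonneg f hP0) y).lt_of_ne' fun h => ?_
    rw [blockProb_eq_rpow_mul f hP0 hw0, h, mul_zero] at hw0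
    exact hw0.false
  have hfib (w' : Fin n → ∀ l, W l) (h : diffSet w w' = S) : (fun i => f (w' i)) = y := by
    funext i k
    have hk : (k : Fin L) ∉ diffSet w w' := by
      rw [h]
      exact Finset.mem_compl.1 k.2
    simp only [diffSet, Finset.mem_filter, Finset.mem_univ, true_and, not_not] at hk
    exact congrFun hk i
  have h1 : ((typicalSet P n δ).filter fun w' => diffSet w w' = S).card *
      ((2 : ℝ) ^ (-(n * (fiberEntropy f P + δ))) * μ) ≤ μ := by
    rw [← nsmul_eq_mul, ← Finset.sum_const]
    calc _ ≤ ∑ w' ∈ (typicalSet P n δ).filter fun w' => diffSet w w' = S, blockProb P w' := by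
          refine Finset.sum_le_sum fun w' hw' => ?_
          obtain ⟨hT, hd⟩ := Finset.mem_filter.1 hw'
          have := (Finset.mem_filter.1 hT).2.2 S
          rwa [← hf, show (fun i => Sᶜ.restrict (w' i)) = y from hfib w' hd] at this
      _ ≤ μ := sum_blockProb_le_of_fiber f hP0 fun w' hw' i =>
          congrFun (hfib w' (Finset.mem_filter.1 hw').2) i
  rw [← mul_assoc, Real.rpow_neg two_pos.le, ← div_eq_mul_inv] at h1
  have h2 := le_of_mul_le_mul_right (h1.trans_eq (one_mul μ).symm) hμ0
  rwa [div_le_one (by positivity)] at h2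

lemma logb_two_ceil_le {x : ℝ} (hx : 0 ≤ x) : Real.logb 2 (⌈(2 : ℝ) ^ x⌉₊ : ℝ) ≤ x + 1 := by
  have h1 : (1 : ℝ) ≤ 2 ^ x := Real.one_le_rpow one_le_two hx
  have h2 : (⌈(2 : ℝ) ^ x⌉₊ : ℝ) < 2 ^ x + 1 := Nat.ceil_lt_add_one (by positivity)
  rw [Real.logb_le_iff_le_rpow one_lt_two (by positivity), Real.rpow_add two_pos, Real.rpow_one]
  linarith

theorem isAchievableRate_of_sourceCondEntropy_le {p : PMF (∀ l, W l)} {r : Fin L → ℝ}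
    (hr : ∀ l, 0 ≤ r l)
    (h : ∀ S : Finset (Fin L), S.Nonempty → S ≠ Finset.univ →
      sourceCondEntropy p S ≤ ∑ l ∈ S, r l) :
    IsAchievableRate p r := by
  classical
  refine ⟨hr, fun ε hε N => ?_⟩
  have : Nonempty (∀ l, W l) := ⟨p.support_nonempty.some⟩
  simp only [sourceCondEntropy_eq_fiberEntropy] at h
  set P : (∀ l, W l) → ℝ := fun v => (p v).toReal with hPdef
  have hP0 : ∀ v, 0 ≤ P v := fun v => ENNReal.toReal_nonneg
  have hP : ∑ v, P v = 1 := sum_toReal_pmf p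
  set c := ∑ S : Finset (Fin L), ∑ v, P v * (surprisal (fun v => Sᶜ.restrict v) P v -
    fiberEntropy (fun v => Sᶜ.restrict v) P) ^ 2 with hc
  obtain ⟨n, ⟨⟨h1, h2⟩, h3⟩, h4⟩ :=
    ((((eventually_div_mul_lt c (d := (ε / 4) ^ 2) (ε := ε / 2) (by positivity) (by positivity)).and
      (eventually_two_rpow_neg_lt (a := ε / 4) (ε := ε / 2 / 2 ^ L) (by positivity)
        (by positivity))).and
      (eventually_div_mul_lt 1 (d := 1) (ε := ε / 2) one_pos (by positivity))).and
      (Filter.eventually_gt_atTop N)).exists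
  have hn : 0 < n := (Nat.zero_le N).trans_lt h4
  have hn' : (0 : ℝ) < n := by exact_mod_cast hn
  -- the margin `ε / 2` in the rates exceeds the slack `ε / 4` in the definition of typicality
  set M : Fin L → ℕ := fun l => ⌈(2 : ℝ) ^ (n * (r l + ε / 2))⌉₊ with hM
  obtain ⟨F, hF⟩ := exists_binningCode_errorProb_le p (typicalSet P n (ε / 4)) (M := M)
    (fun l => Nat.ceil_pos.2 (by positivity)) (fun S => by positivity)
    (fun S w hw => card_typicalSet_diffSet_le hP0 S hw)
  refine ⟨n, h4, binningCode (typicalSet P n (ε / 4)) F, hF.trans ?_, fun l => ?_⟩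
  · have hS (S : Finset (Fin L)) (hS : S ∈ Finset.univ.filter fun S : Finset (Fin L) =>
        S.Nonempty ∧ S ≠ Finset.univ) :
        2 ^ (n * (fiberEntropy (fun v => Sᶜ.restrict v) P + ε / 4)) / ∏ k ∈ S, (M k : ℝ) ≤
          2 ^ (-(n * (ε / 4))) := by
      obtain ⟨hne, hu⟩ := (Finset.mem_filter.1 hS).2
      have hprod : (2 : ℝ) ^ (n * ∑ k ∈ S, (r k + ε / 2)) ≤ ∏ k ∈ S, (M k : ℝ) := by
        rw [Finset.mul_sum, Real.rpow_sum_of_pos two_pos]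
        exact Finset.prod_le_prod (fun k _ => by positivity) fun k _ => Nat.le_ceil _
      have hsum : fiberEntropy (fun v => Sᶜ.restrict v) P + ε / 2 ≤ ∑ k ∈ S, (r k + ε / 2) := by
        rw [Finset.sum_add_distrib, Finset.sum_const, nsmul_eq_mul]
        have : (1 : ℝ) ≤ S.card := by exact_mod_cast hne.card_pos
        have : 1 * (ε / 2) ≤ S.card * (ε / 2) := by gcongr
        linarith [h S hne hu]
      refine (div_le_div_of_nonneg_left (by positivity) (by positivity) hprod).trans ?_
      rw [← Real.rpow_sub two_pos]
      refine Real.rpow_le_rpow_of_exponent_le one_le_two ?_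
      have := mul_le_mul_of_nonneg_left hsum hn'.le
      linarith
    have hcard : ((Finset.univ.filter fun S : Finset (Fin L) =>
        S.Nonempty ∧ S ≠ Finset.univ).card : ℝ) ≤ 2 ^ L := by
      have := Finset.card_le_univ (Finset.univ.filter fun S : Finset (Fin L) =>
        S.Nonempty ∧ S ≠ Finset.univ)
      rw [Fintype.card_finset, Fintype.card_fin] at this
      exact_mod_cast this
    have hsumS := Finset.sum_le_sum hS
    rw [Finset.sum_const, nsmul_eq_mul] at hsumS
    have hb : (2 : ℝ) ^ L * 2 ^ (-(n * (ε / 4))) ≤ ε / 2 := by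
      rw [mul_comm]
      exact ((lt_div_iff₀ (by positivity)).1 h2).le
    have hb' := mul_le_mul_of_nonneg_right hcard
      (Real.rpow_nonneg two_pos.le (-(n * (ε / 4))))
    have := sum_compl_typicalSet_le hP0 hP hn (δ := ε / 4) (by positivity)
    linarith
  · have hl := logb_two_ceil_le (x := n * (r l + ε / 2))
      (mul_nonneg hn'.le (add_nonneg (hr l) (by positivity)))
    rw [mul_one] at h3
    calc (binningCode (typicalSet P n (ε / 4)) F).rate l
        = 1 / n * Real.logb 2 (⌈(2 : ℝ) ^ (n * (r l + ε / 2))⌉₊ : ℝ) := rfl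
      _ ≤ 1 / n * (n * (r l + ε / 2) + 1) := by gcongr
      _ = r l + ε / 2 + 1 / n := by field_simp
      _ ≤ r l + ε := by linarith

end Achievability

theorem lemma3 {L : ℕ} {W : Fin L → Type*} [∀ l, Fintype (W l)] (p : PMF (∀ l, W l)) :
    sourceCodingRegion p =
      {r : Fin L → ℝ | (∀ l, 0 ≤ r l) ∧
        ∀ S : Finset (Fin L), S.Nonempty → S ≠ Finset.univ →
          sourceCondEntropy p S ≤ ∑ l ∈ S, r l} := by
  ext r
  exact ⟨fun h => ⟨h.1, fun _ _ hS => sourceCondEntropy_le_of_isAchievableRate h hS⟩,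
    fun h => isAchievableRate_of_sourceCondEntropy_le h.1 h.2⟩
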